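/- Let $d\in\{1,2,3\}$ and $\lambda>0$, and let $V:\mathbb R^d\to[0,\infty)$ be a Lebesgue measurable function with $V(x)\to\infty$ as $|x|\to\infty$. For $c>0$ put $$S_d(c)=\{u\in H^1(\mathbb R^d;\mathbb C):\ \|u\|_{L^2}=c\},$$ and for $\beta\in\mathbb R$ and $u\in H^1(\mathbb R^d;\mathbb C)$ define the extended Gross–Pitaevskii energy $$E(u)=\int_{\mathbb R^d}\Big(\tfrac12|\nabla u|^2+V(x)|u|^2+\tfrac{\beta}{2}|u|^4+\tfrac{2\lambda}{5}|u|^5\Big)\,dx\ \in(-\infty,+\infty],$$ where $E(u)=+\infty$ if $\int V|u|^2\,dx=\infty$. Then for every $c>0$ and every $\beta\in\mathbb R$ the functional $E$ has a minimizer on $S_d(c)$, and the minimizer can be taken nonnegative: there is $u\in S_d(c)$ with $u\ge 0$ almost everywhere and $E(u)\le E(v)$ for all $v\in S_d(c)$. The minimum is not $-\infty$, and it is finite if $V$ is locally integrable. -/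

import Mathlib

open MeasureTheory Filter Topology
open scoped ContDiff

noncomputable section

namespace EGP

/-- Euclidean space `ℝ^d`. -/
abbrev Space (d : ℕ) : Type := EuclideanSpace ℝ (Fin d)

/-- The space `L²(ℝ^d; ℂ)` of (classes of) square-integrable complex-valued functions, with
Lebesgue measure. -/
abbrev L2 (d : ℕ) : Type := Lp ℂ 2 (volume : Measure (Space d))

/-- `g` is the weak partial derivative `∂ᵢ u`:
`∫ (∂ᵢ φ) u = - ∫ φ g` for every smooth compactly supported test function `φ`. -/
def IsWeakPartial {d : ℕ} (i : Fin d) (u g : L2 d) : Prop :=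
  ∀ φ : Space d → ℝ, ContDiff ℝ ∞ φ → HasCompactSupport φ →
    ∫ x, (fderiv ℝ φ x (EuclideanSpace.single i 1)) • u x = - ∫ x, φ x • g x

/-- Weak partial derivatives are unique. -/
theorem IsWeakPartial.unique {d : ℕ} {i : Fin d} {u g g' : L2 d}
    (h : IsWeakPartial i u g) (h' : IsWeakPartial i u g') : g = g' := by
  have hl : ∀ f : L2 d, LocallyIntegrable f volume := fun f =>
    (Lp.memLp f).locallyIntegrable (by norm_num)
  have key : ∀ᵐ x, (g x - g' x : ℂ) = 0 := by
    refine ae_eq_zero_of_integral_contDiff_smul_eq_zero ((hl g).sub (hl g')) ?_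
    intro φ hφ hc
    have e := (h φ hφ hc).symm.trans (h' φ hφ hc)
    have hi : ∀ f : L2 d, Integrable (fun x => φ x • f x) := fun f =>
      (hl f).integrable_smul_left_of_hasCompactSupport hφ.continuous hc
    simp only [smul_sub]
    rw [integral_sub (hi g) (hi g'), sub_eq_zero]
    exact neg_injective e
  refine Lp.ext ?_
  filter_upwards [key] with x hx using sub_eq_zero.mp hx

/-- `u ∈ H¹(ℝ^d)`: `u ∈ L²` and all weak first partial derivatives exist in `L²`. -/
def MemH1 {d : ℕ} (u : L2 d) : Prop :=
  ∀ i : Fin d, ∃ g : L2 d, IsWeakPartial i u g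

open Classical in
/-- The weak partial derivative `∂ᵢ u` (the zero function if `u` has none in `L²`). -/
def weakPartial {d : ℕ} (i : Fin d) (u : L2 d) : L2 d :=
  if h : ∃ g : L2 d, IsWeakPartial i u g then h.choose else 0

/-- The function `|∇u|² = ∑ᵢ |∂ᵢ u|²`. -/
def gradSq {d : ℕ} (u : L2 d) (x : Space d) : ℝ :=
  ∑ i : Fin d, ‖weakPartial i u x‖ ^ 2

/-- The extended integral `∫ f = ∫ f⁺ - ∫ f⁻` of a real-valued function `f`. It is the usual
Lebesgue integral when `f` is integrable, and it equals `+∞` when `∫ f⁺ = ∞` and `∫ f⁻ < ∞`. -/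
def extIntegral {d : ℕ} (f : Space d → ℝ) : EReal :=
  ((∫⁻ x, ENNReal.ofReal (f x) : ENNReal) : EReal)
    - ((∫⁻ x, ENNReal.ofReal (- f x) : ENNReal) : EReal)

/-- For integrable functions the extended integral is the Lebesgue integral. -/
theorem extIntegral_eq_integral {d : ℕ} {f : Space d → ℝ} (hf : Integrable f volume) :
    extIntegral f = ((∫ x, f x : ℝ) : EReal) := by
  have h1 : ∫⁻ x, ENNReal.ofReal (f x) ≠ ⊤ := hf.lintegral_lt_top.ne
  have h2 : ∫⁻ x, ENNReal.ofReal (- f x) ≠ ⊤ := hf.neg.lintegral_lt_top.ne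
  rw [extIntegral, integral_eq_lintegral_pos_part_sub_lintegral_neg_part hf, EReal.coe_sub,
    EReal.coe_ennreal_toReal h1, EReal.coe_ennreal_toReal h2]

/-- The integrand `½|∇u|² + V|u|² + (β/2)|u|⁴ + (2l/5)|u|⁵` of the extended Gross-Pitaevskii
energy with potential `V` and interaction parameters `β` and `l`. -/
def energyDensity {d : ℕ} (V : Space d → ℝ) (β l : ℝ) (u : L2 d) (x : Space d) : ℝ :=
  1 / 2 * gradSq u x + V x * ‖u x‖ ^ 2 + β / 2 * ‖u x‖ ^ 4 + 2 * l / 5 * ‖u x‖ ^ 5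

/-- The extended Gross-Pitaevskii energy. -/
def energy {d : ℕ} (V : Space d → ℝ) (β l : ℝ) (u : L2 d) : EReal :=
  extIntegral (energyDensity V β l u)

/-- The mass sphere `S_d(c) = {u ∈ H¹(ℝ^d) : ‖u‖₂ = c}`. -/
def massSphere (d : ℕ) (c : ℝ) : Set (L2 d) :=
  {u | MemH1 u ∧ ‖u‖ = c}

end EGP

end

/-! The proof is the direct method. The quintic term dominates the quartic one for large `|u|`, and
a multiple `C|u|²` dominates it for small `|u|` (`exists_interaction_bound`). Adding `C|u|²` makes
the integrand nonnegative and changes the energy on the mass sphere only by the constant `C c²`. The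
shifted energy is then minimized with values in `[0, ∞]`; only nonnegativity and Fatou's lemma are
needed for the powers of `|u|`.

The Dirichlet integral is replaced by `diffQuotSq`, the supremum of the squared `L²` difference
quotients. It is defined on all of `L²`, agrees with `‖∂ᵢu‖²` where the weak derivative exists, and
is infinite otherwise. Lower semicontinuity is then immediate, and so is its decrease under `u ↦
|u|`.

Sublevels of the shifted energy on the sphere are compact in `L²` (`exists_strong_limit`): bounded
difference quotients give strong convergence on balls, and the growth of `V` prevents mass from
escaping to infinity. A minimizer on such a sublevel has finite difference quotients, hence lies in
`H¹`, and its modulus is a nonnegative minimizer. -/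

noncomputable section

namespace EGP

/-! ### Translations on `L²` and weak derivatives -/

/-- Translation `u ↦ u(· + h)` as an isometry of `L²`. -/
def translate {d : ℕ} (h : Space d) : L2 d →ₗᵢ[ℂ] L2 d :=
  Lp.compMeasurePreservingₗᵢ ℂ (fun x => x + h) (measurePreserving_add_right volume h)

theorem coeFn_translate {d : ℕ} (h : Space d) (u : L2 d) :
    translate h u =ᵐ[volume] fun x => u (x + h) :=
  Lp.coeFn_compMeasurePreserving u (measurePreserving_add_right volume h)

theorem translate_translate {d : ℕ} (h k : Space d) (u : L2 d) :
    translate h (translate k u) = translate (h + k) u := by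
  refine Lp.ext ?_
  have h1 := (measurePreserving_add_right (volume : Measure (Space d)) h).quasiMeasurePreserving.ae
    (coeFn_translate k u)
  filter_upwards [coeFn_translate h (translate k u), coeFn_translate (h + k) u, h1]
    with x e1 e2 e3
  rw [e1, e2, e3, add_assoc]

theorem translate_zero {d : ℕ} (u : L2 d) : translate 0 u = u := by
  refine Lp.ext ?_
  filter_upwards [coeFn_translate 0 u] with x hx
  rw [hx, add_zero]

theorem continuous_translate {d : ℕ} (u : L2 d) : Continuous fun h => translate h u := by
  have hg : Continuous fun h : Space d => (⟨fun x => x + h, by fun_prop⟩ : C(Space d, Space d)) :=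
    ContinuousMap.continuous_of_continuous_uncurry _ (by unfold Function.uncurry; simp; fun_prop)
  exact (continuous_const (y := u)).compMeasurePreservingLp hg
    (fun h => measurePreserving_add_right volume h) (by norm_num)

theorem locallyIntegrable_L2 {d : ℕ} (u : L2 d) : LocallyIntegrable u volume :=
  (Lp.memLp u).locallyIntegrable (by norm_num)

/-- Integration against an `L²` function is a bounded functional of the form `⟪f, ·⟫`. -/
theorem exists_inner_eq_integral_smul {d : ℕ} {φ : Space d → ℝ} (hφ : MemLp φ 2 volume) :
    ∃ f : L2 d, ∀ u : L2 d, inner ℂ f u = ∫ x, φ x • u x := by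
  have hm : MemLp (fun x => (φ x : ℂ)) 2 volume := hφ.ofReal
  refine ⟨hm.toLp _, fun u => ?_⟩
  rw [L2.inner_def]
  refine integral_congr_ae ?_
  filter_upwards [hm.coeFn_toLp] with x hx
  rw [hx]
  simp [mul_comm]

/-- The pairing is the convolution of `u` with the reflected test function `φ(-·)`, evaluated at `s
• v`, so the derivative falls on the smooth factor. -/
theorem hasDerivAt_integral_smul_translate {d : ℕ} {φ : Space d → ℝ} (hφ : ContDiff ℝ ∞ φ)
    (hc : HasCompactSupport φ) (u : L2 d) (v : Space d) :
    HasDerivAt (fun s : ℝ => ∫ x, φ x • translate (s • v) u x)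
      (- ∫ x, (fderiv ℝ φ x v) • u x) 0 := by
  set ψ : Space d → ℝ := fun z => φ (-z) with hψ
  have hψd : ContDiff ℝ ∞ ψ := hφ.comp contDiff_neg
  have hψc : HasCompactSupport ψ := hc.comp_homeomorph (Homeomorph.neg _)
  set L : ℂ →L[ℝ] ℝ →L[ℝ] ℂ := (ContinuousLinearMap.lsmul ℝ ℝ).flip with hL
  have hconv := hψc.hasFDerivAt_convolution_right (μ := volume) L (locallyIntegrable_L2 u)
    (hψd.of_le (by exact_mod_cast le_top)) ((0 : ℝ) • v)
  have hline : HasDerivAt (fun s : ℝ => s • v) v 0 := by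
    simpa using (hasDerivAt_id (0 : ℝ)).smul_const v
  have hd := hconv.comp_hasDerivAt (0 : ℝ) hline
  have e1 : (fun s : ℝ => ∫ x, φ x • translate (s • v) u x)
      = (convolution u ψ L volume) ∘ fun s : ℝ => s • v := by
    funext s
    have h1 : ∫ x, φ x • translate (s • v) u x
        = ∫ x, (fun y => φ (y - s • v) • u y) (x + s • v) := by
      refine integral_congr_ae ?_
      filter_upwards [coeFn_translate (s • v) u] with x hx
      simp [hx]
    rw [h1, integral_add_right_eq_self (fun y => φ (y - s • v) • u y)]
    simp [convolution, hψ, hL]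
  have e2 : (convolution u (fderiv ℝ ψ) (L.precompR (Space d)) volume ((0 : ℝ) • v)) v
      = - ∫ x, (fderiv ℝ φ x v) • u x := by
    rw [convolution_precompR_apply L (locallyIntegrable_L2 u) (hψc.fderiv ℝ)
      (hψd.continuous_fderiv (by simp))]
    rw [convolution, ← integral_neg]
    refine integral_congr_ae (Eventually.of_forall fun x => ?_)
    have : fderiv ℝ ψ (-x) v = - fderiv ℝ φ x v := by
      have := ((hφ.differentiable (by simp)) (- -x)).hasFDerivAt.comp (-x)
        (hasFDerivAt_id (𝕜 := ℝ) (-x)).neg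
      rw [show ψ = φ ∘ Neg.neg from rfl, this.fderiv]
      simp
    simp [hL, this]
  rw [e1, ← e2]
  exact hd

theorem IsWeakPartial.translate {d : ℕ} {i : Fin d} {u g : L2 d} (h : IsWeakPartial i u g)
    (k : Space d) : IsWeakPartial i (translate k u) (translate k g) := by
  intro φ hφ hc
  have key : ∀ (ψ : Space d → ℝ) (f : L2 d),
      ∫ x, ψ x • EGP.translate k f x = ∫ x, ψ (x - k) • f x := by
    intro ψ f
    rw [← integral_add_right_eq_self (fun y => ψ (y - k) • f y) k]
    refine integral_congr_ae ?_
    filter_upwards [coeFn_translate k f] with x hx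
    simp [hx]
  rw [key (fun x => fderiv ℝ φ x (EuclideanSpace.single i 1)), key]
  have := h (fun x => φ (x - k)) (hφ.comp (contDiff_id.sub contDiff_const))
    (hc.comp_homeomorph (Homeomorph.subRight k))
  simpa only [fderiv_comp_sub] using this

/-- The fundamental theorem of calculus `u(· + t eᵢ) - u = ∫₀ᵗ ∂ᵢu(· + s eᵢ) ds` in `L²`. -/
theorem IsWeakPartial.translate_sub_eq {d : ℕ} {i : Fin d} {u g : L2 d} (h : IsWeakPartial i u g)
    (t : ℝ) : EGP.translate (t • EuclideanSpace.single i 1) u - u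
      = ∫ s in (0 : ℝ)..t, EGP.translate (s • EuclideanSpace.single i 1) g := by
  set e : Space d := EuclideanSpace.single i 1
  have hcont : Continuous fun s : ℝ => EGP.translate (s • e) g :=
    (continuous_translate g).comp (by fun_prop)
  set w := EGP.translate (t • e) u - u - ∫ s in (0 : ℝ)..t, EGP.translate (s • e) g with hw
  suffices w = 0 from sub_eq_zero.mp this
  have : ∀ᵐ x, w x = 0 := by
    refine ae_eq_zero_of_integral_contDiff_smul_eq_zero (locallyIntegrable_L2 w) ?_
    intro φ hφ hc
    obtain ⟨f, hf⟩ := exists_inner_eq_integral_smul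
      (hφ.continuous.memLp_of_hasCompactSupport (μ := volume) hc)
    -- Testing against `φ` reduces the claim to the scalar fundamental theorem of calculus. The
    -- derivative at `s` is the derivative at `0` for the translated function, by the group law.
    have hder : ∀ s : ℝ, HasDerivAt (fun s : ℝ => inner ℂ f (EGP.translate (s • e) u))
        (inner ℂ f (EGP.translate (s • e) g)) s := by
      intro s
      have h0 := hasDerivAt_integral_smul_translate hφ hc (EGP.translate (s • e) u) e
      rw [(h.translate (s • e)) φ hφ hc, neg_neg, ← hf] at h0
      simp_rw [← hf, translate_translate, ← add_smul] at h0
      have h1 : HasDerivAt (fun r : ℝ => r - s) 1 s := (hasDerivAt_id s).sub_const s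
      have h2 := HasDerivAt.scomp_of_eq s h0 h1 (by simp)
      simpa [Function.comp_def] using h2
    have hint := intervalIntegral.integral_eq_sub_of_hasDerivAt (a := 0) (b := t)
      (fun s _ => hder s)
      ((Continuous.inner (𝕜 := ℂ) (continuous_const (y := f)) hcont).intervalIntegrable _ _)
    rw [← hf, hw, inner_sub_right, inner_sub_right]
    have hcomm := (innerSL ℂ f).intervalIntegral_comp_comm
      (hcont.intervalIntegrable (μ := volume) 0 t)
    simp only [innerSL_apply_apply] at hcomm
    rw [← hcomm, hint]
    simp [translate_zero]
  exact Lp.ext (by filter_upwards [this, Lp.coeFn_zero ℂ 2 volume] with x hx h0; rw [hx, h0]; rfl)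

/-- Translations are isometries, so the integrand in the fundamental theorem of calculus has
constant norm `‖g‖`. -/
theorem IsWeakPartial.norm_translate_sub_le {d : ℕ} {i : Fin d} {u g : L2 d}
    (h : IsWeakPartial i u g) (t : ℝ) :
    ‖EGP.translate (t • EuclideanSpace.single i 1) u - u‖ ≤ |t| * ‖g‖ := by
  rw [h.translate_sub_eq]
  refine (intervalIntegral.norm_integral_le_of_norm_le_const (C := ‖g‖) fun s _ => ?_).trans ?_
  · rw [LinearIsometry.norm_map]
  · rw [sub_zero, mul_comm]

/-! ### Weak limits in Hilbert space -/

section Weak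

variable {H : Type*} [NormedAddCommGroup H] [InnerProductSpace ℂ H] [CompleteSpace H]

/-- Bounded sequences in a separable Hilbert space have weakly convergent subsequences. -/
theorem exists_weak_limit [TopologicalSpace.SeparableSpace H] {u : ℕ → H} {C : ℝ}
    (hC : ∀ n, ‖u n‖ ≤ C) : ∃ w : H, ∃ ns : ℕ → ℕ, StrictMono ns ∧
      ∀ f : H, Tendsto (fun n => inner ℂ f (u (ns n))) atTop (𝓝 (inner ℂ f w)) := by
  -- Sequential Banach–Alaoglu in the dual, transported by the Riesz map; that map puts `u n` in the
  -- conjugate-linear slot, hence the conjugation below.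
  have hs := WeakDual.isSeqCompact_closedBall ℂ H (0 : StrongDual ℂ H) C
  obtain ⟨a, -, ns, hns, ha⟩ := hs (x := fun n =>
    StrongDual.toWeakDual (InnerProductSpace.toDual ℂ H (u n))) (fun n => by
      have : ‖InnerProductSpace.toDual ℂ H (u n)‖ ≤ C := by simpa using hC n
      simpa using this)
  refine ⟨(InnerProductSpace.toDual ℂ H).symm (WeakDual.toStrongDual a), ns, hns, fun f => ?_⟩
  have h1 := ((WeakDual.eval_continuous f).tendsto a).comp ha
  have h2 := (Complex.continuous_conj.tendsto _).comp h1
  have e : inner ℂ f ((InnerProductSpace.toDual ℂ H).symm (WeakDual.toStrongDual a))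
      = (starRingEnd ℂ) (a f) := by
    rw [← inner_conj_symm, InnerProductSpace.toDual_symm_apply]
    rfl
  rw [e]
  refine h2.congr fun n => ?_
  simp only [Function.comp]
  rw [← inner_conj_symm]
  rfl

/-- Bounds on images under a bounded operator pass to weak limits. -/
theorem norm_apply_le_of_weak_limit {u : ℕ → H} {w : H}
    (hw : ∀ f : H, Tendsto (fun n => inner ℂ f (u n)) atTop (𝓝 (inner ℂ f w)))
    (T : H →L[ℂ] H) {C : ℝ} (hC : ∀ n, ‖T (u n)‖ ≤ C) : ‖T w‖ ≤ C := by
  -- This test vector gives `⟪T w, T (u n)⟫ → ‖T w‖²`, and Cauchy–Schwarz bounds the left side by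
  -- `‖T w‖ * C`.
  have h1 := hw (ContinuousLinearMap.adjoint T (T w))
  simp only [ContinuousLinearMap.adjoint_inner_left] at h1
  have h2 : ‖inner ℂ (T w) (T w)‖ ≤ ‖T w‖ * C :=
    le_of_tendsto h1.norm (Eventually.of_forall fun n =>
      (norm_inner_le_norm _ _).trans (mul_le_mul_of_nonneg_left (hC n) (norm_nonneg _)))
  rw [inner_self_eq_norm_sq_to_K, norm_pow] at h2
  rcases (norm_nonneg (T w)).eq_or_lt with h0 | h0
  · rw [← h0]
    exact (norm_nonneg _).trans (hC 0)
  · refine le_of_mul_le_mul_left ?_ h0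
    simpa [sq] using h2

end Weak

/-! ### Difference quotients and the Dirichlet integral -/

variable {d : ℕ}

/-- Difference quotients along `1 / (n + 1)` are bounded in `L²`. Any weak subsequential limit is
the weak derivative, since pairings with test functions are differentiable at `0`. -/
theorem exists_isWeakPartial {i : Fin d} {u : L2 d} {M : ℝ}
    (h : ∀ t : ℝ, ‖translate (t • EuclideanSpace.single i 1) u - u‖ ≤ |t| * M) :
    ∃ g : L2 d, IsWeakPartial i u g ∧ ‖g‖ ≤ M := by
  set e : Space d := EuclideanSpace.single i 1 with he
  set τ : ℕ → ℝ := fun n => 1 / ((n : ℝ) + 1) with hτ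
  have hτ0 : ∀ n, 0 < τ n := fun n => Nat.one_div_pos_of_nat
  set q : ℕ → L2 d := fun n => ((τ n)⁻¹ : ℂ) • (translate (τ n • e) u - u) with hq
  have hb : ∀ n, ‖q n‖ ≤ M := by
    intro n
    rw [hq]
    simp only [norm_smul, norm_inv, Complex.norm_real, Real.norm_eq_abs]
    rw [inv_mul_le_iff₀ (abs_pos.2 (hτ0 n).ne')]
    exact h _
  have : Fact ((2 : ENNReal) ≠ ⊤) := ⟨by norm_num⟩
  obtain ⟨g, ns, hns, hg⟩ := exists_weak_limit hb
  refine ⟨g, fun φ hφ hc => ?_, by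
    simpa using norm_apply_le_of_weak_limit hg (ContinuousLinearMap.id ℂ _) fun n => hb (ns n)⟩
  obtain ⟨f, hf⟩ := exists_inner_eq_integral_smul
    (hφ.continuous.memLp_of_hasCompactSupport (μ := volume) hc)
  have h0 := hasDerivAt_integral_smul_translate hφ hc u e
  simp_rw [← hf] at h0
  rw [hasDerivAt_iff_tendsto_slope_zero] at h0
  have hτt : Tendsto (fun n => τ (ns n)) atTop (𝓝[≠] 0) := by
    refine tendsto_nhdsWithin_iff.2
      ⟨tendsto_one_div_add_atTop_nhds_zero_nat.comp hns.tendsto_atTop, ?_⟩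
    exact Eventually.of_forall fun n => (hτ0 _).ne'
  have h1 := h0.comp hτt
  have h2 : Tendsto (fun n => inner ℂ f (q (ns n))) atTop
      (𝓝 (-∫ x, (fderiv ℝ φ x e) • u x)) := by
    refine h1.congr fun n => ?_
    simp [hq, translate_zero, inner_smul_right, inner_sub_right]
  have h3 := tendsto_nhds_unique h2 (hg f)
  rw [hf] at h3
  rw [← h3, neg_neg]

theorem lintegral_norm_sq (u : L2 d) :
    ∫⁻ x, ENNReal.ofReal (‖u x‖ ^ 2) = ENNReal.ofReal (‖u‖ ^ 2) := by
  have h1 : ‖u‖ₑ ^ 2 = ∫⁻ x, ‖u x‖ₑ ^ 2 := by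
    have := eLpNorm_nnreal_pow_eq_lintegral (f := u) (μ := volume) (p := 2) (by norm_num)
    simp only [ENNReal.coe_ofNat, NNReal.coe_ofNat, ENNReal.rpow_ofNat] at this
    rw [← this, Lp.enorm_def]
  rw [ENNReal.ofReal_pow (norm_nonneg _), ofReal_norm, h1]
  simp only [ENNReal.ofReal_pow (norm_nonneg _), ofReal_norm]

/-- The squared supremum of the `L²` norms of the difference quotients in direction `eᵢ`.
It equals `‖∂ᵢu‖²` if the weak derivative exists in `L²`, and `∞` otherwise. -/
def diffQuotSq (i : Fin d) (u : L2 d) : ENNReal :=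
  ⨆ t : ℝ, ENNReal.ofReal (‖translate (t • EuclideanSpace.single i 1) u - u‖ ^ 2 / t ^ 2)

theorem diffQuotSq_le {i : Fin d} {u : L2 d} {M : ℝ}
    (h : ∀ t : ℝ, ‖translate (t • EuclideanSpace.single i 1) u - u‖ ≤ |t| * M) :
    diffQuotSq i u ≤ ENNReal.ofReal (M ^ 2) := by
  refine iSup_le fun t => ENNReal.ofReal_le_ofReal ?_
  -- At `t = 0` the quotient is `0` by convention, so that index adds nothing to the supremum.
  refine div_le_of_le_mul₀ (sq_nonneg t) (sq_nonneg M) ?_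
  calc _ ≤ (|t| * M) ^ 2 := pow_le_pow_left₀ (norm_nonneg _) (h t) 2
    _ = _ := by rw [mul_pow, sq_abs, mul_comm]

theorem norm_translate_sub_le_of_diffQuotSq_le {i : Fin d} {u : L2 d} {M : ℝ} (hM : 0 ≤ M)
    (h : diffQuotSq i u ≤ ENNReal.ofReal (M ^ 2)) (t : ℝ) :
    ‖translate (t • EuclideanSpace.single i 1) u - u‖ ≤ |t| * M := by
  rcases eq_or_ne t 0 with rfl | ht
  · simp [translate_zero]
  have h1 := (le_iSup (fun t : ℝ => ENNReal.ofReal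
    (‖translate (t • EuclideanSpace.single i 1) u - u‖ ^ 2 / t ^ 2)) t).trans h
  rw [ENNReal.ofReal_le_ofReal_iff (sq_nonneg M), div_le_iff₀ (by positivity)] at h1
  refine le_of_sq_le_sq ?_ (by positivity)
  rw [mul_pow, sq_abs, mul_comm]
  exact h1

theorem exists_isWeakPartial_of_diffQuotSq_le {i : Fin d} {u : L2 d} {M : ℝ} (hM : 0 ≤ M)
    (h : diffQuotSq i u ≤ ENNReal.ofReal (M ^ 2)) :
    ∃ g : L2 d, IsWeakPartial i u g ∧ ‖g‖ ≤ M :=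
  exists_isWeakPartial (norm_translate_sub_le_of_diffQuotSq_le hM h)

theorem exists_isWeakPartial_of_diffQuotSq_ne_top {i : Fin d} {u : L2 d}
    (h : diffQuotSq i u ≠ ⊤) : ∃ g : L2 d, IsWeakPartial i u g := by
  obtain ⟨g, hg, -⟩ := exists_isWeakPartial_of_diffQuotSq_le (M := √(diffQuotSq i u).toReal)
    (Real.sqrt_nonneg _) (by rw [Real.sq_sqrt ENNReal.toReal_nonneg, ENNReal.ofReal_toReal h])
  exact ⟨g, hg⟩

/-- The upper bound is the fundamental theorem of calculus. For the lower bound, the weak limit of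
difference quotients has norm at most their supremum, and it equals `g` by uniqueness. -/
theorem IsWeakPartial.diffQuotSq_eq {i : Fin d} {u g : L2 d} (h : IsWeakPartial i u g) :
    diffQuotSq i u = ENNReal.ofReal (‖g‖ ^ 2) := by
  have hle := diffQuotSq_le h.norm_translate_sub_le
  refine le_antisymm hle ?_
  have htop : diffQuotSq i u ≠ ⊤ := ne_top_of_le_ne_top ENNReal.ofReal_ne_top hle
  obtain ⟨g', hg', hn⟩ := exists_isWeakPartial_of_diffQuotSq_le (M := √(diffQuotSq i u).toReal)
    (Real.sqrt_nonneg _) (by rw [Real.sq_sqrt ENNReal.toReal_nonneg, ENNReal.ofReal_toReal htop])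
  rw [h.unique hg', ← ENNReal.ofReal_toReal htop]
  refine ENNReal.ofReal_le_ofReal ?_
  calc _ ≤ (√(diffQuotSq i u).toReal) ^ 2 := pow_le_pow_left₀ (norm_nonneg _) hn 2
    _ = _ := Real.sq_sqrt ENNReal.toReal_nonneg

/-- A supremum of continuous functions; this is the gain over defining the functional through the
derivative itself. -/
theorem lowerSemicontinuous_diffQuotSq (i : Fin d) :
    LowerSemicontinuous (diffQuotSq i : L2 d → ENNReal) := by
  refine lowerSemicontinuous_iSup fun t => Continuous.lowerSemicontinuous ?_
  refine ENNReal.continuous_ofReal.comp (Continuous.div_const (Continuous.pow (Continuous.norm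
    (Continuous.sub ?_ continuous_id)) 2) _)
  exact (translate _).continuous

theorem memH1_of_sum_diffQuotSq_ne_top {u : L2 d} (h : ∑ i, diffQuotSq i u ≠ ⊤) : MemH1 u :=
  fun i => exists_isWeakPartial_of_diffQuotSq_ne_top
    (ne_top_of_le_ne_top h (Finset.single_le_sum (f := fun i => diffQuotSq i u)
      (fun _ _ => zero_le) (Finset.mem_univ i)))

theorem isWeakPartial_weakPartial {u : L2 d} (h : MemH1 u) (i : Fin d) :
    IsWeakPartial i u (weakPartial i u) := by
  unfold weakPartial
  rw [dif_pos (h i)]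
  exact (h i).choose_spec

theorem aemeasurable_norm (u : L2 d) : AEMeasurable (fun x => ‖u x‖) volume :=
  (Lp.aestronglyMeasurable u).norm.aemeasurable

theorem gradSq_nonneg (u : L2 d) (x : Space d) : 0 ≤ gradSq u x :=
  Finset.sum_nonneg fun _ _ => sq_nonneg _

theorem aemeasurable_gradSq (u : L2 d) : AEMeasurable (gradSq u) volume :=
  Finset.aemeasurable_fun_sum _ fun i _ => (aemeasurable_norm (weakPartial i u)).pow_const 2

theorem lintegral_gradSq {u : L2 d} (h : MemH1 u) :
    ∫⁻ x, ENNReal.ofReal (gradSq u x) = ∑ i, diffQuotSq i u := by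
  unfold gradSq
  simp_rw [ENNReal.ofReal_sum_of_nonneg fun i _ => sq_nonneg _]
  rw [lintegral_finsetSum' _ fun i _ => ((aemeasurable_norm _).pow_const 2).ennreal_ofReal]
  refine Finset.sum_congr rfl fun i _ => ?_
  rw [lintegral_norm_sq, (isWeakPartial_weakPartial h i).diffQuotSq_eq]

/-! ### The modulus -/

theorem lipschitzWith_norm_ofReal : LipschitzWith 1 (fun z : ℂ => ((‖z‖ : ℝ) : ℂ)) :=
  LipschitzWith.of_dist_le_mul fun x y => by
    rw [Complex.dist_eq, ← Complex.ofReal_sub, Complex.norm_real, NNReal.coe_one, one_mul,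
      Complex.dist_eq]
    exact abs_norm_sub_norm_le x y

/-- The modulus `|u|` of an `L²` function. -/
def modulus (u : L2 d) : L2 d := lipschitzWith_norm_ofReal.compLp (by simp) u

theorem coeFn_modulus (u : L2 d) : modulus u =ᵐ[volume] fun x => ((‖u x‖ : ℝ) : ℂ) :=
  lipschitzWith_norm_ofReal.coeFn_compLp (by simp) u

theorem norm_modulus_apply (u : L2 d) : ∀ᵐ x, ‖modulus u x‖ = ‖u x‖ := by
  filter_upwards [coeFn_modulus u] with x hx
  simp [hx]

theorem norm_modulus (u : L2 d) : ‖modulus u‖ = ‖u‖ := by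
  rw [Lp.norm_def, Lp.norm_def, eLpNorm_congr_norm_ae (norm_modulus_apply u)]

theorem translate_modulus (h : Space d) (u : L2 d) :
    translate h (modulus u) = modulus (translate h u) := by
  refine Lp.ext ?_
  have h1 := (measurePreserving_add_right (volume : Measure (Space d)) h).quasiMeasurePreserving.ae
    (coeFn_modulus u)
  filter_upwards [coeFn_translate h (modulus u), coeFn_modulus (translate h u), h1,
    coeFn_translate h u] with x e1 e2 e3 e4
  rw [e1, e2, e3, e4]

theorem norm_modulus_sub_le (u v : L2 d) : ‖modulus u - modulus v‖ ≤ ‖u - v‖ :=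
  (lipschitzWith_norm_ofReal.norm_compLp_sub_le (by simp) u v).trans_eq (one_mul _)

/-- Taking the modulus commutes with translations and is 1-Lipschitz on `L²`, so each difference
quotient shrinks; no chain rule for `|u|` enters. -/
theorem diffQuotSq_modulus_le (i : Fin d) (u : L2 d) :
    diffQuotSq i (modulus u) ≤ diffQuotSq i u := by
  refine iSup_mono fun t => ENNReal.ofReal_le_ofReal ?_
  rw [translate_modulus]
  gcongr
  exact norm_modulus_sub_le _ _

/-! ### Local compactness through ball averages -/

theorem sq_lintegral_le {α : Type*} [MeasurableSpace α] (μ : Measure α) {f : α → ENNReal}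
    (hf : AEMeasurable f μ) : (∫⁻ x, f x ∂μ) ^ 2 ≤ μ Set.univ * ∫⁻ x, f x ^ 2 ∂μ := by
  have h := ENNReal.lintegral_mul_le_Lp_mul_Lq μ Real.HolderConjugate.two_two
    (aemeasurable_const (b := (1 : ENNReal))) hf
  simp only [Pi.mul_apply, one_mul, lintegral_const, ENNReal.rpow_ofNat] at h
  calc (∫⁻ x, f x ∂μ) ^ 2
      ≤ (μ Set.univ ^ (1 / 2 : ℝ) * (∫⁻ x, f x ^ 2 ∂μ) ^ (1 / 2 : ℝ)) ^ 2 := by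
        gcongr
        simpa using h
    _ = _ := by
        rw [mul_pow, ← ENNReal.rpow_mul_natCast, ← ENNReal.rpow_mul_natCast]
        norm_num

theorem enorm_add_sq_le {E : Type*} [SeminormedAddCommGroup E] (a b : E) :
    ‖a + b‖ₑ ^ 2 ≤ 2 * (‖a‖ₑ ^ 2 + ‖b‖ₑ ^ 2) := by
  have h : ‖a + b‖₊ ^ 2 ≤ 2 * (‖a‖₊ ^ 2 + ‖b‖₊ ^ 2) :=
    (pow_le_pow_left₀ zero_le (nnnorm_add_le a b) 2).trans add_sq_le
  simp only [enorm_eq_nnnorm]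
  exact_mod_cast h

theorem lintegral_enorm_sq (u : L2 d) : ∫⁻ x, ‖u x‖ₑ ^ 2 = ‖u‖ₑ ^ 2 := by
  have := lintegral_norm_sq u
  simpa only [ENNReal.ofReal_pow (norm_nonneg _), ofReal_norm] using this

/-- Move along the coordinate axes one at a time; by isometry each move costs as much as it does
starting from `u`. -/
theorem norm_translate_sub_le {u : L2 d} {M : ℝ}
    (h : ∀ (i : Fin d) (t : ℝ), ‖translate (t • EuclideanSpace.single i 1) u - u‖ ≤ |t| * M)
    (v : Space d) : ‖translate v u - u‖ ≤ (∑ i, |v i|) * M := by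
  have key : ∀ s : Finset (Fin d),
      ‖translate (∑ i ∈ s, v i • EuclideanSpace.single i (1 : ℝ)) u - u‖
        ≤ (∑ i ∈ s, |v i|) * M := by
    intro s
    induction s using Finset.induction_on with
    | empty => simp [translate_zero]
    | insert i s hi ih =>
      rw [Finset.sum_insert hi, Finset.sum_insert hi, ← translate_translate, add_mul]
      set a : Space d := v i • EuclideanSpace.single i 1
      set b : Space d := ∑ i ∈ s, v i • EuclideanSpace.single i (1 : ℝ)
      calc ‖translate a (translate b u) - u‖
          = ‖(translate a u - u) + translate a (translate b u - u)‖ := by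
            rw [map_sub]; congr 1; abel
        _ ≤ ‖translate a u - u‖ + ‖translate b u - u‖ := by
            rw [← (translate a).norm_map (translate b u - u)]
            exact norm_add_le _ _
        _ ≤ _ := add_le_add (h i (v i)) ih
  have hv : ∑ i, v i • EuclideanSpace.single i (1 : ℝ) = v := by
    ext j
    simp [Finset.sum_apply, Pi.single_apply]
  simpa [hv] using key Finset.univ

theorem norm_translate_sub_le_norm {u : L2 d} {M : ℝ} (hM : 0 ≤ M)
    (h : ∀ i, diffQuotSq i u ≤ ENNReal.ofReal (M ^ 2)) (v : Space d) :
    ‖translate v u - u‖ ≤ d * M * ‖v‖ := by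
  refine (norm_translate_sub_le
    (fun i => norm_translate_sub_le_of_diffQuotSq_le hM (h i)) v).trans ?_
  have : ∑ i, |v i| ≤ d * ‖v‖ := by
    refine (Finset.sum_le_card_nsmul _ _ ‖v‖ fun i _ => ?_).trans (by simp)
    simpa using PiLp.norm_apply_le v i
  calc _ ≤ (d * ‖v‖) * M := by gcongr
    _ = _ := by ring

/-- The indicator function of the ball of radius `ε` around the origin. -/
def ballIndicator (d : ℕ) (ε : ℝ) : L2 d :=
  indicatorConstLp 2 measurableSet_ball (measure_ball_lt_top (x := (0 : Space d)) (r := ε)).ne 1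

theorem inner_ballIndicator_translate (ε : ℝ) (w : L2 d) (x : Space d) :
    inner ℂ (ballIndicator d ε) (translate x w) = ∫ y in Metric.ball 0 ε, w (y + x) := by
  rw [ballIndicator, L2.inner_indicatorConstLp_one]
  exact integral_congr_ae (ae_restrict_of_ae (coeFn_translate x w))

/-- The left side is the integral of `w x - w (x + y)` over `y` in the ball, to which Cauchy–Schwarz
applies. The average is left unnormalized so that it is an inner product with a fixed vector. -/
theorem enorm_sub_ballAverage_sq_le (ε : ℝ) (w : L2 d) (x : Space d) :
    ‖(volume.real (Metric.ball (0 : Space d) ε)) • w x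
        - inner ℂ (ballIndicator d ε) (translate x w)‖ₑ ^ 2
      ≤ volume (Metric.ball (0 : Space d) ε)
        * ∫⁻ y in Metric.ball (0 : Space d) ε, ‖w (x + y) - w x‖ₑ ^ 2 := by
  have hint : IntegrableOn (fun y => w (y + x)) (Metric.ball 0 ε) volume := by
    have : IntegrableOn (translate x w) (Metric.ball 0 ε) volume :=
      ((locallyIntegrable_L2 _).integrableOn_isCompact (isCompact_closedBall 0 ε)).mono_set
        Metric.ball_subset_closedBall
    exact this.congr_fun_ae (ae_restrict_of_ae (coeFn_translate x w))
  have hmeas : Measurable fun y => w (x + y) - w x :=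
    ((Lp.stronglyMeasurable w).measurable.comp (measurable_const_add x)).sub_const _
  have : IsFiniteMeasure (volume.restrict (Metric.ball (0 : Space d) ε)) :=
    ⟨by rw [Measure.restrict_apply_univ]; exact measure_ball_lt_top⟩
  rw [inner_ballIndicator_translate, ← setIntegral_const, ← integral_sub
    (integrable_const _) hint]
  refine (pow_le_pow_left₀ zero_le (enorm_integral_le_lintegral_enorm _) 2).trans ?_
  refine (sq_lintegral_le _ ?_).trans ?_
  · exact (measurable_const.sub ((Lp.stronglyMeasurable w).measurable.comp
      (measurable_add_const x))).enorm.aemeasurable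
  · rw [Measure.restrict_apply_univ]
    simp_rw [fun y => enorm_sub_rev (w x) (w (y + x)), fun y => add_comm y x]
    rfl

/-- Integrate the pointwise bound and exchange integrals: for each `y` the inner integral is
`‖translate y w - w‖²`. -/
theorem lintegral_sub_ballAverage_le {ε K : ℝ} {w : L2 d}
    (h : ∀ y ∈ Metric.ball (0 : Space d) ε, ‖translate y w - w‖ ≤ K) :
    ∫⁻ x, ‖(volume.real (Metric.ball (0 : Space d) ε)) • w x
        - inner ℂ (ballIndicator d ε) (translate x w)‖ₑ ^ 2
      ≤ volume (Metric.ball (0 : Space d) ε) ^ 2 * ENNReal.ofReal K ^ 2 := by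
  have hmeas : Measurable (Function.uncurry fun x y : Space d => ‖w (x + y) - w x‖ₑ ^ 2) := by
    have hw := (Lp.stronglyMeasurable w).measurable
    exact ((hw.comp (measurable_fst.add measurable_snd)).sub
      (hw.comp measurable_fst)).enorm.pow_const 2
  refine (lintegral_mono fun x => enorm_sub_ballAverage_sq_le ε w x).trans ?_
  rw [lintegral_const_mul' _ _ measure_ball_lt_top.ne, lintegral_lintegral_swap hmeas.aemeasurable,
    sq, mul_assoc]
  gcongr
  have : ∀ y ∈ Metric.ball (0 : Space d) ε,
      ∫⁻ x, ‖w (x + y) - w x‖ₑ ^ 2 ≤ ENNReal.ofReal K ^ 2 := by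
    intro y hy
    have e : ∫⁻ x, ‖w (x + y) - w x‖ₑ ^ 2 = ‖translate y w - w‖ₑ ^ 2 := by
      rw [← lintegral_enorm_sq]
      refine lintegral_congr_ae ?_
      filter_upwards [coeFn_translate y w, Lp.coeFn_sub (translate y w) w] with x h1 h2
      rw [h2, Pi.sub_apply, h1]
    rw [e, ← ofReal_norm]
    gcongr
    exact h y hy
  refine (setLIntegral_mono measurable_const this).trans ?_
  rw [setLIntegral_const, mul_comm]

theorem continuous_ballAverage (ε : ℝ) (w : L2 d) :
    Continuous fun x => (inner ℂ (ballIndicator d ε) (translate x w) : ℂ) :=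
  (continuous_const (y := ballIndicator d ε)).inner (𝕜 := ℂ) (continuous_translate w)

theorem lintegral_ball_sq_le {ε K : ℝ} {w : L2 d}
    (h : ∀ y ∈ Metric.ball (0 : Space d) ε, ‖translate y w - w‖ ≤ K) (s : Set (Space d)) :
    volume (Metric.ball (0 : Space d) ε) ^ 2 * ∫⁻ x in s, ‖w x‖ₑ ^ 2
      ≤ 2 * (∫⁻ x in s, ‖(inner ℂ (ballIndicator d ε) (translate x w) : ℂ)‖ₑ ^ 2)
        + 2 * (volume (Metric.ball (0 : Space d) ε) ^ 2 * ENNReal.ofReal K ^ 2) := by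
  have hm : volume (Metric.ball (0 : Space d) ε)
      = ‖volume.real (Metric.ball (0 : Space d) ε)‖ₑ := by
    rw [Real.enorm_of_nonneg measureReal_nonneg, ofReal_measureReal measure_ball_lt_top.ne]
  have hpt : ∀ x, volume (Metric.ball (0 : Space d) ε) ^ 2 * ‖w x‖ₑ ^ 2
      ≤ 2 * ‖(inner ℂ (ballIndicator d ε) (translate x w) : ℂ)‖ₑ ^ 2
        + 2 * ‖(volume.real (Metric.ball (0 : Space d) ε)) • w x
          - inner ℂ (ballIndicator d ε) (translate x w)‖ₑ ^ 2 := by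
    intro x
    rw [hm, ← mul_pow, ← enorm_smul, ← mul_add]
    refine le_trans (le_of_eq ?_) (enorm_add_sq_le _ _)
    rw [add_sub_cancel]
  rw [← lintegral_const_mul' _ _ (ENNReal.pow_ne_top measure_ball_lt_top.ne)]
  refine (lintegral_mono hpt).trans ?_
  rw [lintegral_add_left (((continuous_ballAverage ε w).measurable.enorm.pow_const 2).const_mul 2),
    lintegral_const_mul' _ _ (by norm_num), lintegral_const_mul' _ _ (by norm_num)]
  gcongr
  exact (setLIntegral_le_lintegral _ _).trans (lintegral_sub_ballAverage_le h)

/-- Rellich's theorem: weakly null sequences that are equicontinuous in `L²` under translations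
converge strongly on bounded sets. -/
theorem tendsto_lintegral_ball_of_weak {w : ℕ → L2 d} {C K : ℝ} (hC : ∀ n, ‖w n‖ ≤ C)
    (hw : ∀ f : L2 d, Tendsto (fun n => (inner ℂ f (w n) : ℂ)) atTop (𝓝 0))
    (hK : ∀ n v, ‖translate v (w n) - w n‖ ≤ K * ‖v‖) (R : ℝ) :
    Tendsto (fun n => ∫⁻ x in Metric.ball (0 : Space d) R, ‖w n x‖ₑ ^ 2) atTop (𝓝 0) := by
  have hK0 : 0 ≤ |K| := abs_nonneg K
  rw [ENNReal.tendsto_nhds_zero]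
  intro δ hδ
  -- The averaging radius is fixed first, making the averaging error at most half of `δ` uniformly
  -- in `n`.
  obtain ⟨ε, hε, hεδ⟩ : ∃ ε : ℝ, 0 < ε ∧ 2 * ENNReal.ofReal (|K| * ε) ^ 2 ≤ δ / 2 := by
    have hcont : Tendsto (fun ε : ℝ => 2 * ENNReal.ofReal (|K| * ε) ^ 2) (𝓝[>] 0) (𝓝 0) := by
      have h1 : Continuous fun ε : ℝ => ENNReal.ofReal ((|K| * ε) ^ 2) :=
        ENNReal.continuous_ofReal.comp (by fun_prop)
      have h2 := ENNReal.Tendsto.const_mul (a := 2) (h1.tendsto 0) (Or.inr (by norm_num))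
      simp only [mul_zero, ne_eq, OfNat.ofNat_ne_zero, not_false_eq_true, zero_pow,
        ENNReal.ofReal_zero] at h2
      refine (h2.mono_left nhdsWithin_le_nhds).congr' ?_
      filter_upwards [self_mem_nhdsWithin] with ε hε
      rw [ENNReal.ofReal_pow (mul_nonneg hK0 (le_of_lt hε))]
    have := (hcont.eventually (ge_mem_nhds (ENNReal.half_pos hδ.ne'))).and self_mem_nhdsWithin
    obtain ⟨ε, h1, h2⟩ := this.exists
    exact ⟨ε, h2, h1⟩
  set m := volume (Metric.ball (0 : Space d) ε) with hm
  have hm0 : m ≠ 0 := (Metric.measure_ball_pos volume 0 hε).ne'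
  have hmt : m ≠ ⊤ := measure_ball_lt_top.ne
  set f := ballIndicator d ε
  have hbound : ∀ n x, ‖(inner ℂ f (translate x (w n)) : ℂ)‖ ≤ ‖f‖ * C := fun n x =>
    (norm_inner_le_norm _ _).trans (mul_le_mul_of_nonneg_left
      (by rw [LinearIsometry.norm_map]; exact hC n) (norm_nonneg _))
  have hlim : Tendsto (fun n => ∫⁻ x in Metric.ball (0 : Space d) R,
      ‖(inner ℂ f (translate x (w n)) : ℂ)‖ₑ ^ 2) atTop (𝓝 0) := by
    have := tendsto_lintegral_of_dominated_convergence
      (μ := volume.restrict (Metric.ball (0 : Space d) R))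
      (F := fun n x => ‖(inner ℂ f (translate x (w n)) : ℂ)‖ₑ ^ 2) (f := fun _ => 0)
      (fun _ => ENNReal.ofReal (‖f‖ * C) ^ 2)
      (fun n => (continuous_ballAverage ε (w n)).measurable.enorm.pow_const 2)
      (fun n => Eventually.of_forall fun x => by
        dsimp only
        rw [← ofReal_norm]
        gcongr
        exact hbound n x)
      (by
        rw [setLIntegral_const]
        exact ENNReal.mul_ne_top (ENNReal.pow_ne_top ENNReal.ofReal_ne_top)
          measure_ball_lt_top.ne)
      (Eventually.of_forall fun x => by
        -- At a fixed `x` the average is the pairing of `w n` with a fixed vector, so weak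
        -- convergence gives pointwise convergence.
        have h1 := hw (ContinuousLinearMap.adjoint (translate x).toContinuousLinearMap f)
        simp only [ContinuousLinearMap.adjoint_inner_left] at h1
        have h2 := ((ENNReal.continuous_pow 2).tendsto _).comp h1.enorm
        simpa [Function.comp_def] using h2)
    simpa using this
  have hpos : 0 < m ^ 2 * (δ / 2) / 2 :=
    ENNReal.half_pos (mul_ne_zero (pow_ne_zero 2 hm0) (ENNReal.half_pos hδ.ne').ne')
  filter_upwards [hlim.eventually (ge_mem_nhds hpos)] with n hn
  have h1 := lintegral_ball_sq_le (ε := ε) (K := |K| * ε) (w := w n) (fun y hy => by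
    refine (hK n y).trans ?_
    have : ‖y‖ ≤ ε := by simpa using (Metric.mem_ball.1 hy).le
    exact mul_le_mul (le_abs_self K) this (norm_nonneg _) hK0) (Metric.ball 0 R)
  rw [← hm] at h1
  have h2 : m ^ 2 * ∫⁻ x in Metric.ball (0 : Space d) R, ‖w n x‖ₑ ^ 2 ≤ m ^ 2 * δ := by
    refine h1.trans ?_
    calc _ ≤ 2 * (m ^ 2 * (δ / 2) / 2) + m ^ 2 * (δ / 2) := by
          refine add_le_add (mul_le_mul_right hn 2) ?_
          rw [mul_left_comm]
          exact mul_le_mul_right hεδ _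
      _ = m ^ 2 * δ := by
          rw [ENNReal.mul_div_cancel (by norm_num) (by norm_num), ← mul_add, ENNReal.add_halves]
  exact (ENNReal.mul_le_mul_iff_right (pow_ne_zero 2 hm0) (ENNReal.pow_ne_top hmt)).1 h2

/-! ### Confinement and strong compactness -/

theorem eventually_lintegral_compl_ball_le (u : L2 d) {δ : ENNReal} (hδ : 0 < δ) :
    ∀ᶠ n : ℕ in atTop, ∫⁻ x in (Metric.ball (0 : Space d) n)ᶜ, ‖u x‖ₑ ^ 2 ≤ δ := by
  have hmeas : Measurable fun x => ‖u x‖ₑ ^ 2 :=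
    (Lp.stronglyMeasurable u).measurable.enorm.pow_const 2
  have : Tendsto (fun n : ℕ => ∫⁻ x in (Metric.ball (0 : Space d) n)ᶜ, ‖u x‖ₑ ^ 2)
      atTop (𝓝 0) := by
    simp_rw [← lintegral_indicator measurableSet_ball.compl]
    rw [← lintegral_zero (μ := (volume : Measure (Space d)))]
    refine tendsto_lintegral_of_dominated_convergence (fun x => ‖u x‖ₑ ^ 2)
      (fun n => hmeas.indicator measurableSet_ball.compl)
      (fun n => Eventually.of_forall fun x => Set.indicator_le_self _ _ _)
      (by rw [lintegral_enorm_sq]; exact ENNReal.pow_ne_top enorm_ne_top)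
      (Eventually.of_forall fun x => ?_)
    obtain ⟨N, hN⟩ := exists_nat_gt ‖x‖
    refine tendsto_const_nhds.congr' ?_
    filter_upwards [eventually_ge_atTop N] with n hn
    rw [Set.indicator_of_notMem]
    simp only [Set.mem_compl_iff, not_not, Metric.mem_ball, dist_zero_right]
    exact hN.trans_le (by exact_mod_cast hn)
  exact this.eventually (ge_mem_nhds hδ)

/-- Chebyshev's inequality: where `V ≥ L` the mass is at most `Q / L`. The radius depends on `V`,
`Q` and `δ` only, so the bound is uniform in `u`. -/
theorem eventually_lintegral_compl_ball_le_of_potential {V : Space d → ℝ}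
    (hV : Tendsto V (cocompact (Space d)) atTop) {Q : ENNReal} (hQ : Q ≠ ⊤)
    {δ : ENNReal} (hδ : 0 < δ) :
    ∀ᶠ n : ℕ in atTop, ∀ u : L2 d, ∫⁻ x, ENNReal.ofReal (V x * ‖u x‖ ^ 2) ≤ Q →
      ∫⁻ x in (Metric.ball (0 : Space d) n)ᶜ, ‖u x‖ₑ ^ 2 ≤ δ := by
  obtain ⟨L, hL0, hL⟩ : ∃ L : ℝ, 0 < L ∧ Q ≤ ENNReal.ofReal L * δ := by
    rcases eq_or_ne δ ⊤ with rfl | hδt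
    · exact ⟨1, one_pos, by simp⟩
    · have hq : Q / δ ≠ ⊤ := ENNReal.div_ne_top hQ hδ.ne'
      refine ⟨(Q / δ).toReal + 1, by positivity, ?_⟩
      rw [← ENNReal.div_le_iff hδ.ne' hδt]
      refine (ENNReal.ofReal_toReal hq).symm.le.trans (ENNReal.ofReal_le_ofReal (by linarith))
  have h1 := hV.eventually (eventually_ge_atTop L)
  rw [← Metric.cobounded_eq_cocompact, ← comap_norm_atTop, eventually_comap,
    eventually_atTop] at h1
  obtain ⟨R, hR⟩ := h1
  filter_upwards [eventually_ge_atTop ⌈R⌉₊] with n hn u hu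
  have hn' : R ≤ n := Nat.ceil_le.1 hn
  have h2 : ENNReal.ofReal L * ∫⁻ x in (Metric.ball (0 : Space d) n)ᶜ, ‖u x‖ₑ ^ 2
      ≤ ENNReal.ofReal L * δ := by
    rw [← lintegral_const_mul' _ _ ENNReal.ofReal_ne_top]
    refine le_trans ?_ (hu.trans hL)
    refine le_trans ?_ (setLIntegral_le_lintegral (Metric.ball (0 : Space d) n)ᶜ _)
    refine setLIntegral_mono' measurableSet_ball.compl fun x hx => ?_
    rw [← ofReal_norm, ← ENNReal.ofReal_pow (norm_nonneg _), ← ENNReal.ofReal_mul hL0.le]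
    refine ENNReal.ofReal_le_ofReal (mul_le_mul_of_nonneg_right ?_ (sq_nonneg _))
    refine hR ‖x‖ ?_ x rfl
    simp only [Set.mem_compl_iff, Metric.mem_ball, dist_zero_right, not_lt] at hx
    exact hn'.trans hx
  exact (ENNReal.mul_le_mul_iff_right (by simpa using hL0) ENNReal.ofReal_ne_top).1 h2

/-- The bounded operator `u ↦ u(· + v) - u`. -/
def translateSub (v : Space d) : L2 d →L[ℂ] L2 d :=
  (translate v).toContinuousLinearMap - ContinuousLinearMap.id ℂ _

/-- Compactness of the embedding of the energy space with a confining potential into `L²`. -/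
theorem exists_strong_limit {V : Space d → ℝ} (hV : Tendsto V (cocompact (Space d)) atTop)
    {u : ℕ → L2 d} {C M : ℝ} {Q : ENNReal} (hM : 0 ≤ M) (hQ : Q ≠ ⊤) (hC : ∀ n, ‖u n‖ ≤ C)
    (hD : ∀ n i, diffQuotSq i (u n) ≤ ENNReal.ofReal (M ^ 2))
    (hP : ∀ n, ∫⁻ x, ENNReal.ofReal (V x * ‖u n x‖ ^ 2) ≤ Q) :
    ∃ w : L2 d, ∃ ns : ℕ → ℕ, StrictMono ns ∧ Tendsto (u ∘ ns) atTop (𝓝 w) := by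
  have : Fact ((2 : ENNReal) ≠ ⊤) := ⟨by norm_num⟩
  obtain ⟨w, ns, hns, hw⟩ := exists_weak_limit hC
  refine ⟨w, ns, hns, ?_⟩
  have hτ : ∀ n v, ‖translate v (u n) - u n‖ ≤ d * M * ‖v‖ := fun n v =>
    norm_translate_sub_le_norm hM (hD n) v
  -- The translation estimate passes to the weak limit, so the differences `u (ns n) - w` satisfy
  -- one with twice the constant.
  have hτw : ∀ v, ‖translate v w - w‖ ≤ d * M * ‖v‖ := fun v =>
    norm_apply_le_of_weak_limit hw (translateSub v) fun n => hτ (ns n) v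
  have hCw : ‖w‖ ≤ C :=
    norm_apply_le_of_weak_limit hw (ContinuousLinearMap.id ℂ _) fun n => hC (ns n)
  have hlocal := tendsto_lintegral_ball_of_weak (w := fun n => u (ns n) - w) (C := C + C)
    (K := d * M + d * M)
    (fun n => (norm_sub_le _ _).trans (add_le_add (hC _) hCw))
    (fun f => by
      simp_rw [inner_sub_right]
      simpa using (hw f).sub_const (inner ℂ f w))
    (fun n v => by
      rw [map_sub, sub_sub_sub_comm, add_mul]
      exact (norm_sub_le _ _).trans (add_le_add (hτ _ v) (hτw v)))
  have hmain : Tendsto (fun n => ‖u (ns n) - w‖ₑ ^ 2) atTop (𝓝 0) := by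
    rw [ENNReal.tendsto_nhds_zero]
    intro δ hδ
    -- Each tail gets `δ / 8`, as `|a - b|² ≤ 2(|a|² + |b|²)` turns two of them into `δ / 2`; the
    -- ball gets the other half.
    have hδ8 : 0 < δ / 8 := ENNReal.div_pos hδ.ne' (by norm_num)
    obtain ⟨R, h1, h2⟩ := ((eventually_lintegral_compl_ball_le w hδ8).and
      (eventually_lintegral_compl_ball_le_of_potential hV hQ hδ8)).exists
    filter_upwards [(hlocal R).eventually (ge_mem_nhds (ENNReal.half_pos hδ.ne'))] with n hn
    rw [← lintegral_enorm_sq, ← lintegral_add_compl _ (measurableSet_ball (x := 0) (ε := R))]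
    have h3 : ∫⁻ x in (Metric.ball (0 : Space d) R)ᶜ, ‖(u (ns n) - w) x‖ₑ ^ 2 ≤ δ / 2 := by
      calc _ ≤ ∫⁻ x in (Metric.ball (0 : Space d) R)ᶜ, 2 * (‖u (ns n) x‖ₑ ^ 2 + ‖w x‖ₑ ^ 2) := by
            refine lintegral_mono_ae (ae_restrict_of_ae ?_)
            filter_upwards [Lp.coeFn_sub (u (ns n)) w] with x hx
            rw [hx, Pi.sub_apply, sub_eq_add_neg]
            simpa using enorm_add_sq_le (u (ns n) x) (-w x)
        _ ≤ 2 * (δ / 8 + δ / 8) := by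
            rw [lintegral_const_mul' _ _ (by norm_num), lintegral_add_left
              ((Lp.stronglyMeasurable _).measurable.enorm.pow_const 2)]
            gcongr
            exact h2 _ (hP _)
        _ = δ / 2 := by
            rw [← two_mul, ← mul_assoc, show (2 * 2 : ENNReal) = 4 by norm_num,
              show (8 : ENNReal) = 4 * 2 by norm_num, div_eq_mul_inv, div_eq_mul_inv,
              ENNReal.mul_inv (by norm_num) (by norm_num), mul_left_comm, ← mul_assoc 4,
              ENNReal.mul_inv_cancel (by norm_num) (by norm_num), one_mul]
    exact (add_le_add hn h3).trans_eq (ENNReal.add_halves δ)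
  rw [tendsto_iff_norm_sub_tendsto_zero]
  have h4 := (ENNReal.tendsto_toReal (by norm_num : (0 : ENNReal) ≠ ⊤)).comp hmain
  have h5 := (Real.continuous_sqrt.tendsto _).comp h4
  simpa [Function.comp_def] using h5

/-! ### The shifted energy -/

/-- If `∫ F = ∞`, the positive part of `F - p` still has infinite integral, while the negative part
is at most `p⁺`, hence integrable: both sides are `+∞`. -/
theorem extIntegral_sub {F p : Space d → ℝ} (hF : AEMeasurable F volume) (hF0 : ∀ x, 0 ≤ F x)
    (hp : Integrable p volume) :
    extIntegral (fun x => F x - p x)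
      = ((∫⁻ x, ENNReal.ofReal (F x) : ENNReal) : EReal) - ((∫ x, p x : ℝ) : EReal) := by
  by_cases h : ∫⁻ x, ENNReal.ofReal (F x) = ⊤
  · have h1 : ∫⁻ x, ENNReal.ofReal (F x - p x) = ⊤ := by
      by_contra hne
      have h2 : ∫⁻ x, ENNReal.ofReal (F x)
          ≤ (∫⁻ x, ENNReal.ofReal (F x - p x)) + ∫⁻ x, ENNReal.ofReal (p x) := by
        rw [← lintegral_add_right' _ hp.aestronglyMeasurable.aemeasurable.ennreal_ofReal]
        refine lintegral_mono fun x => ?_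
        refine le_trans (le_of_eq ?_) ENNReal.ofReal_add_le
        rw [sub_add_cancel]
      rw [h, top_le_iff, ENNReal.add_eq_top] at h2
      exact h2.elim hne hp.lintegral_lt_top.ne
    have h2 : ∫⁻ x, ENNReal.ofReal (-(F x - p x)) ≠ ⊤ := by
      refine ne_top_of_le_ne_top hp.lintegral_lt_top.ne
        (lintegral_mono fun x => ENNReal.ofReal_le_ofReal ?_)
      linarith [hF0 x]
    rw [extIntegral, h1, h, ← EReal.coe_ennreal_toReal h2]
    simp
  · have hFi : Integrable F volume := by
      refine ⟨hF.aestronglyMeasurable, ?_⟩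
      rw [hasFiniteIntegral_iff_ofReal (Eventually.of_forall hF0)]
      exact lt_top_iff_ne_top.2 h
    rw [show (fun x => F x - p x) = F - p from rfl, extIntegral_eq_integral (hFi.sub hp),
      integral_sub' hFi hp,
      integral_eq_lintegral_of_nonneg_ae (Eventually.of_forall hF0) hF.aestronglyMeasurable,
      EReal.coe_sub, EReal.coe_ennreal_toReal h]

/-- The sum of the quartic and quintic interaction is bounded below by a multiple of the density. -/
theorem exists_interaction_bound (β : ℝ) {l : ℝ} (hl : 0 < l) :
    ∃ C : ℝ, ∀ s : ℝ, 0 ≤ s → 0 ≤ C * s ^ 2 + β / 2 * s ^ 4 + 2 * l / 5 * s ^ 5 := by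
  -- At amplitude `r` the quintic term equals `|β|/2 * s ^ 4`. Above `r` it absorbs the quartic
  -- term; below `r` the quadratic term does.
  set r := 5 * |β| / (4 * l) with hr
  have hr0 : 0 ≤ r := by positivity
  have hlr : 2 * l / 5 * r = |β| / 2 := by rw [hr]; field_simp; ring
  refine ⟨|β| / 2 * r ^ 2, fun s hs => ?_⟩
  have hβ : -|β| ≤ β := neg_abs_le β
  have key : 0 ≤ |β| / 2 * r ^ 2 - |β| / 2 * s ^ 2 + 2 * l / 5 * s ^ 3 := by
    rcases le_total s r with h | h
    · have : s ^ 2 ≤ r ^ 2 := pow_le_pow_left₀ hs h 2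
      have h3 : 0 ≤ 2 * l / 5 * s ^ 3 := by positivity
      nlinarith [abs_nonneg β]
    · have h3 : 2 * l / 5 * r * s ^ 2 ≤ 2 * l / 5 * s * s ^ 2 := by gcongr
      have h4 : 0 ≤ |β| / 2 * r ^ 2 := by positivity
      rw [hlr] at h3
      nlinarith
  nlinarith [mul_nonneg (sq_nonneg s) key, mul_nonneg (by linarith : 0 ≤ β + |β|)
    (pow_nonneg hs 4)]

/-- The density of the energy without its gradient part, shifted by `C|u|²`. -/
def potentialDensity (V : Space d → ℝ) (β l C : ℝ) (u : L2 d) (x : Space d) : ℝ :=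
  V x * ‖u x‖ ^ 2 + (C * ‖u x‖ ^ 2 + β / 2 * ‖u x‖ ^ 4 + 2 * l / 5 * ‖u x‖ ^ 5)

/-- The energy shifted by `C‖u‖²`, as a functional on all of `L²`. -/
def shiftedEnergy (V : Space d → ℝ) (β l C : ℝ) (u : L2 d) : ENNReal :=
  ENNReal.ofReal (1 / 2) * ∑ i, diffQuotSq i u
    + ∫⁻ x, ENNReal.ofReal (potentialDensity V β l C u x)

theorem aemeasurable_potentialDensity {V : Space d → ℝ} (hV : AEMeasurable V volume)
    (β l C : ℝ) (u : L2 d) : AEMeasurable (potentialDensity V β l C u) volume :=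
  (hV.mul ((aemeasurable_norm u).pow_const 2)).add
    (((((aemeasurable_norm u).pow_const 2).const_mul C).add
      (((aemeasurable_norm u).pow_const 4).const_mul (β / 2))).add
      (((aemeasurable_norm u).pow_const 5).const_mul (2 * l / 5)))

theorem integrable_norm_sq (u : L2 d) : Integrable (fun x => ‖u x‖ ^ 2) volume :=
  (Lp.memLp u).integrable_norm_pow (by norm_num)

theorem integral_norm_sq (u : L2 d) : ∫ x, ‖u x‖ ^ 2 = ‖u‖ ^ 2 := by
  rw [integral_eq_lintegral_of_nonneg_ae (Eventually.of_forall fun x => sq_nonneg _)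
    (integrable_norm_sq u).aestronglyMeasurable, lintegral_norm_sq,
    ENNReal.toReal_ofReal (sq_nonneg _)]

section

variable {V : Space d → ℝ} {β l C : ℝ}

theorem potentialDensity_nonneg (hV0 : ∀ x, 0 ≤ V x)
    (hC : ∀ s : ℝ, 0 ≤ s → 0 ≤ C * s ^ 2 + β / 2 * s ^ 4 + 2 * l / 5 * s ^ 5)
    (u : L2 d) (x : Space d) : 0 ≤ potentialDensity V β l C u x :=
  add_nonneg (mul_nonneg (hV0 x) (sq_nonneg _)) (hC _ (norm_nonneg _))

/-- The condition `MemH1` matters: outside `H¹` a missing derivative counts as `0` in `gradSq`, but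
makes `diffQuotSq` infinite. -/
theorem energy_eq_shiftedEnergy_sub (hVm : AEMeasurable V volume) (hV0 : ∀ x, 0 ≤ V x)
    (hC : ∀ s : ℝ, 0 ≤ s → 0 ≤ C * s ^ 2 + β / 2 * s ^ 4 + 2 * l / 5 * s ^ 5)
    {u : L2 d} (hu : MemH1 u) :
    energy V β l u = (shiftedEnergy V β l C u : EReal) - ((C * ‖u‖ ^ 2 : ℝ) : EReal) := by
  have e : energyDensity V β l u
      = fun x => (1 / 2 * gradSq u x + potentialDensity V β l C u x) - C * ‖u x‖ ^ 2 := by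
    funext x
    unfold energyDensity potentialDensity
    ring
  have hg : AEMeasurable (fun x => 1 / 2 * gradSq u x) volume :=
    (aemeasurable_gradSq u).const_mul _
  rw [energy, e, extIntegral_sub (F := fun x => 1 / 2 * gradSq u x + potentialDensity V β l C u x)
    (hg.add (aemeasurable_potentialDensity hVm β l C u))
    (fun x => add_nonneg (mul_nonneg (by norm_num) (gradSq_nonneg u x))
      (potentialDensity_nonneg hV0 hC u x))
    ((integrable_norm_sq u).const_mul C),
    integral_const_mul, integral_norm_sq]
  congr 2
  simp_rw [fun x => ENNReal.ofReal_add (mul_nonneg (by norm_num : (0 : ℝ) ≤ 1 / 2)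
    (gradSq_nonneg u x)) (potentialDensity_nonneg hV0 hC u x)]
  rw [lintegral_add_left' hg.ennreal_ofReal, shiftedEnergy, ← lintegral_gradSq hu,
    ← lintegral_const_mul' _ _ ENNReal.ofReal_ne_top]
  simp_rw [← ENNReal.ofReal_mul (by norm_num : (0 : ℝ) ≤ 1 / 2)]

/-! ### Lower semicontinuity and compact sublevels -/

/-- Fatou's lemma along an almost everywhere convergent subsequence; the density is continuous in
the value of `u` at fixed `x`, so `V` needs no continuity. -/
theorem lowerSemicontinuous_lintegral_potentialDensity (hVm : AEMeasurable V volume) :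
    LowerSemicontinuous fun u : L2 d => ∫⁻ x, ENNReal.ofReal (potentialDensity V β l C u x) := by
  rw [lowerSemicontinuous_iff_isClosed_preimage]
  intro a
  refine IsSeqClosed.isClosed fun u w hu hw => ?_
  obtain ⟨ns, -, hns⟩ := (tendstoInMeasure_of_tendsto_Lp hw).exists_seq_tendsto_ae
  have h1 : ∫⁻ x, ENNReal.ofReal (potentialDensity V β l C w x)
      ≤ ∫⁻ x, liminf (fun n => ENNReal.ofReal (potentialDensity V β l C (u (ns n)) x)) atTop := by
    refine lintegral_mono_ae ?_
    filter_upwards [hns] with x hx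
    have hcont : Continuous fun z : ℂ => ENNReal.ofReal
        (V x * ‖z‖ ^ 2 + (C * ‖z‖ ^ 2 + β / 2 * ‖z‖ ^ 4 + 2 * l / 5 * ‖z‖ ^ 5)) :=
      ENNReal.continuous_ofReal.comp (by fun_prop)
    exact ((hcont.tendsto (w x)).comp hx).liminf_eq.ge
  refine (h1.trans (lintegral_liminf_le' fun n =>
    (aemeasurable_potentialDensity hVm β l C (u (ns n))).ennreal_ofReal)).trans ?_
  exact (liminf_le_liminf (Eventually.of_forall fun n => hu (ns n))).trans
    (le_of_eq (liminf_const a))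

theorem lowerSemicontinuous_shiftedEnergy (hVm : AEMeasurable V volume) :
    LowerSemicontinuous (shiftedEnergy V β l C : L2 d → ENNReal) := by
  refine LowerSemicontinuous.add ?_ (lowerSemicontinuous_lintegral_potentialDensity hVm)
  exact (ENNReal.continuous_const_mul ENNReal.ofReal_ne_top).comp_lowerSemicontinuous
    (lowerSemicontinuous_sum fun i _ => lowerSemicontinuous_diffQuotSq i)
    fun a b hab => mul_le_mul_right hab _

theorem shiftedEnergy_modulus_le (u : L2 d) :
    shiftedEnergy V β l C (modulus u) ≤ shiftedEnergy V β l C u := by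
  refine add_le_add (mul_le_mul_right (Finset.sum_le_sum fun i _ => diffQuotSq_modulus_le i u) _)
    (le_of_eq (lintegral_congr_ae ?_))
  filter_upwards [norm_modulus_apply u] with x hx
  simp only [potentialDensity, hx]

theorem sum_diffQuotSq_le_shiftedEnergy (u : L2 d) :
    ∑ i, diffQuotSq i u ≤ 2 * shiftedEnergy V β l C u := by
  rw [shiftedEnergy, mul_add, ← mul_assoc]
  refine le_trans (le_of_eq ?_) le_self_add
  rw [show (2 : ENNReal) = ENNReal.ofReal 2 by simp, ← ENNReal.ofReal_mul (by norm_num)]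
  norm_num

theorem memH1_of_shiftedEnergy_ne_top {u : L2 d} (h : shiftedEnergy V β l C u ≠ ⊤) : MemH1 u :=
  memH1_of_sum_diffQuotSq_ne_top (ne_top_of_le_ne_top (ENNReal.mul_ne_top (by norm_num) h)
    (sum_diffQuotSq_le_shiftedEnergy (V := V) (β := β) (l := l) (C := C) u))

/-- The level `a` bounds the difference quotients by `2 * a` and the potential energy by `a`. Strong
convergence keeps the norm equal to `c`, and lower semicontinuity keeps the energy bound. -/
theorem isCompact_shiftedEnergy_sublevel (hVm : AEMeasurable V volume)
    (hV : Tendsto V (cocompact (Space d)) atTop)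
    (hC : ∀ s : ℝ, 0 ≤ s → 0 ≤ C * s ^ 2 + β / 2 * s ^ 4 + 2 * l / 5 * s ^ 5)
    (c : ℝ) {a : ENNReal} (ha : a ≠ ⊤) :
    IsCompact {u : L2 d | ‖u‖ = c ∧ shiftedEnergy V β l C u ≤ a} := by
  have hclosed : IsClosed {u : L2 d | ‖u‖ = c ∧ shiftedEnergy V β l C u ≤ a} :=
    (isClosed_eq continuous_norm continuous_const).inter
      ((lowerSemicontinuous_shiftedEnergy hVm).isClosed_preimage a)
  refine IsSeqCompact.isCompact fun u hu => ?_
  have h2a : 2 * a ≠ ⊤ := ENNReal.mul_ne_top (by norm_num) ha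
  obtain ⟨w, ns, hns, hw⟩ := exists_strong_limit hV (u := u) (C := c) (M := √(2 * a).toReal)
    (Q := a) (Real.sqrt_nonneg _) ha (fun n => (hu n).1.le)
    (fun n i => by
      rw [Real.sq_sqrt ENNReal.toReal_nonneg, ENNReal.ofReal_toReal h2a]
      exact (Finset.single_le_sum (f := fun i => diffQuotSq i (u n)) (fun _ _ => zero_le)
        (Finset.mem_univ i)).trans ((sum_diffQuotSq_le_shiftedEnergy (u n)).trans
          (mul_le_mul_right (hu n).2 2)))
    (fun n => (lintegral_mono fun x => ENNReal.ofReal_le_ofReal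
      (le_add_of_nonneg_right (hC _ (norm_nonneg _)))).trans (le_add_self.trans (hu n).2))
  exact ⟨w, hclosed.mem_of_tendsto hw (Eventually.of_forall fun n => hu (ns n)), ns, hns, hw⟩

/-! ### Competitors on the mass sphere -/

/-- Smooth compactly supported functions belong to `H¹`. -/
theorem memH1_toLp {φ : Space d → ℝ} (hφ : ContDiff ℝ ∞ φ) (hc : HasCompactSupport φ)
    (hm : MemLp (fun x => (φ x : ℂ)) 2 (volume : Measure (Space d))) : MemH1 (hm.toLp _) := by
  intro i
  set e : Space d := EuclideanSpace.single i 1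
  have hdc : Continuous fun x => fderiv ℝ φ x e :=
    (hφ.continuous_fderiv (by simp)).clm_apply continuous_const
  have hds : HasCompactSupport fun x => fderiv ℝ φ x e := hc.fderiv_apply ℝ e
  have hdm : MemLp (fun x => ((fderiv ℝ φ x e : ℝ) : ℂ)) 2 (volume : Measure (Space d)) :=
    (hdc.memLp_of_hasCompactSupport hds).ofReal
  refine ⟨hdm.toLp _, fun ψ hψ hψc => ?_⟩
  have hψd : Continuous fun x => fderiv ℝ ψ x e :=
    (hψ.continuous_fderiv (by simp)).clm_apply continuous_const
  have h1 := integral_mul_fderiv_eq_neg_fderiv_mul_of_integrable (μ := volume) (f := ψ) (g := φ)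
    (v := e) ((hψd.mul hφ.continuous).integrable_of_hasCompactSupport hc.mul_left)
    ((hψ.continuous.mul hdc).integrable_of_hasCompactSupport hds.mul_left)
    ((hψ.continuous.mul hφ.continuous).integrable_of_hasCompactSupport hc.mul_left)
    (fun x _ => hψ.differentiable (by simp) x) (fun x _ => hφ.differentiable (by simp) x)
  have h2 : ∫ x, fderiv ℝ ψ x e • hm.toLp _ x = ((∫ x, fderiv ℝ ψ x e * φ x : ℝ) : ℂ) := by
    rw [← integral_complex_ofReal]
    refine integral_congr_ae ?_
    filter_upwards [hm.coeFn_toLp] with x hx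
    simp [hx]
  have h3 : ∫ x, ψ x • hdm.toLp _ x = ((∫ x, ψ x * fderiv ℝ φ x e : ℝ) : ℂ) := by
    rw [← integral_complex_ofReal]
    refine integral_congr_ae ?_
    filter_upwards [hdm.coeFn_toLp] with x hx
    simp [hx]
  rw [h2, h3, h1]
  simp

/-- The mass sphere contains a nonnegative bump function, whose energy is finite for locally
integrable potentials. -/
theorem exists_mem_massSphere (V : Space d → ℝ) (β l C : ℝ) {c : ℝ} (hc : 0 < c) :
    ∃ u ∈ massSphere d c, (∀ᵐ x, 0 ≤ (u x).re ∧ (u x).im = 0) ∧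
      (LocallyIntegrable V volume → shiftedEnergy V β l C u ≠ ⊤) := by
  let b : ContDiffBump (0 : Space d) := ⟨1, 2, one_pos, one_lt_two⟩
  have hb2 : MemLp (fun x => (b x : ℂ)) 2 (volume : Measure (Space d)) :=
    (b.continuous.memLp_of_hasCompactSupport b.hasCompactSupport).ofReal
  have hb0 : ‖hb2.toLp _‖ ≠ 0 := by
    intro h0
    have h1 : (fun x => (b x : ℂ)) =ᵐ[volume] fun _ => (0 : ℂ) := by
      have h2 : hb2.toLp _ =ᵐ[volume] (0 : Space d → ℂ) := by
        rw [norm_eq_zero.1 h0]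
        exact Lp.coeFn_zero _ _ _
      exact hb2.coeFn_toLp.symm.trans h2
    have h3 := congrFun ((Continuous.ae_eq_iff_eq volume
      (Complex.continuous_ofReal.comp b.continuous) continuous_const).1 h1) 0
    have h4 : b (0 : Space d) = 1 := b.one_of_mem_closedBall (by simp [b])
    simp [h4] at h3
  set k : ℝ := c / ‖hb2.toLp _‖ with hk
  have hk0 : 0 ≤ k := by positivity
  set φ : Space d → ℝ := fun x => k * b x with hφ
  have hφd : ContDiff ℝ ∞ φ := contDiff_const.mul b.contDiff
  have hφc : HasCompactSupport φ := b.hasCompactSupport.mul_left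
  have hm : MemLp (fun x => (φ x : ℂ)) 2 (volume : Measure (Space d)) :=
    (hφd.continuous.memLp_of_hasCompactSupport hφc).ofReal
  have hmem := memH1_toLp hφd hφc hm
  have hnorm : ‖hm.toLp _‖ = c := by
    have e : hm.toLp _ = (k : ℂ) • hb2.toLp _ := by
      rw [← MemLp.toLp_const_smul]
      congr 1
      funext x
      simp [hφ]
    rw [e, norm_smul, Complex.norm_real, Real.norm_eq_abs, abs_of_nonneg hk0, hk,
      div_mul_cancel₀ _ hb0]
  refine ⟨hm.toLp _, ⟨hmem, hnorm⟩, ?_, fun hVl => ?_⟩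
  · filter_upwards [hm.coeFn_toLp] with x hx
    rw [hx]
    exact ⟨by simpa using mul_nonneg hk0 b.nonneg, by simp⟩
  · refine ENNReal.add_ne_top.2 ⟨ENNReal.mul_ne_top ENNReal.ofReal_ne_top ?_, ?_⟩
    · refine (ENNReal.sum_lt_top.2 fun i _ => ?_).ne
      rw [(isWeakPartial_weakPartial hmem i).diffQuotSq_eq]
      exact ENNReal.ofReal_lt_top
    · have hpow : ∀ n : ℕ, n ≠ 0 → HasCompactSupport fun x => φ x ^ n := fun n hn =>
        hφc.comp_left (g := fun y : ℝ => y ^ n) (zero_pow hn)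
      have hpi : ∀ n : ℕ, n ≠ 0 → Integrable (fun x => φ x ^ n) volume := fun n hn =>
        (hφd.continuous.pow n).integrable_of_hasCompactSupport (hpow n hn)
      have hint : Integrable (fun x => V x * φ x ^ 2
          + (C * φ x ^ 2 + β / 2 * φ x ^ 4 + 2 * l / 5 * φ x ^ 5)) volume := by
        refine Integrable.add ?_ ((((hpi 2 (by norm_num)).const_mul C).add
          ((hpi 4 (by norm_num)).const_mul _)).add ((hpi 5 (by norm_num)).const_mul _))
        exact hVl.integrable_smul_right_of_hasCompactSupport (hφd.continuous.pow 2)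
          (hpow 2 (by norm_num))
      refine ne_of_lt (lt_of_eq_of_lt (lintegral_congr_ae ?_) hint.lintegral_lt_top)
      filter_upwards [hm.coeFn_toLp] with x hx
      have hx' : ‖hm.toLp _ x‖ = φ x := by
        rw [hx, Complex.norm_real, Real.norm_eq_abs, abs_of_nonneg (mul_nonneg hk0 b.nonneg)]
      rw [potentialDensity, hx']

end

end EGP

end

/-! ### Existence of the minimizer -/

theorem theorem3p2 (d : ℕ) (hd : d = 1 ∨ d = 2 ∨ d = 3) (l : ℝ) (hl : 0 < l)
    (V : EGP.Space d → ℝ) (hVm : AEMeasurable V volume) (hV0 : ∀ x, 0 ≤ V x)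
    (hV : Tendsto V (cocompact (EGP.Space d)) atTop)
    (c : ℝ) (hc : 0 < c) (β : ℝ) :
    ∃ u ∈ EGP.massSphere d c,
      (∀ᵐ x, 0 ≤ (u x).re ∧ (u x).im = 0) ∧
      IsMinOn (EGP.energy V β l) (EGP.massSphere d c) u ∧
      ⊥ < EGP.energy V β l u ∧
      (LocallyIntegrable V volume → EGP.energy V β l u < ⊤) := by
  obtain ⟨C, hC⟩ := EGP.exists_interaction_bound β hl
  have hE : ∀ u ∈ EGP.massSphere d c, EGP.energy V β l u
      = (EGP.shiftedEnergy V β l C u : EReal) - ((C * c ^ 2 : ℝ) : EReal) := fun u hu => by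
    rw [EGP.energy_eq_shiftedEnergy_sub hVm hV0 hC hu.1, hu.2]
  obtain ⟨u₀, hu₀, hpos₀, hfin₀⟩ := EGP.exists_mem_massSphere V β l C hc
  suffices ∃ u ∈ EGP.massSphere d c, (∀ᵐ x, 0 ≤ (u x).re ∧ (u x).im = 0) ∧
      ∀ v ∈ EGP.massSphere d c, EGP.shiftedEnergy V β l C u ≤ EGP.shiftedEnergy V β l C v by
    obtain ⟨u, hu, hpos, hmin⟩ := this
    refine ⟨u, hu, hpos, isMinOn_iff.2 fun v hv => ?_, ?_, fun hVl => ?_⟩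
    · rw [hE u hu, hE v hv]
      exact EReal.sub_le_sub (by exact_mod_cast hmin v hv) le_rfl
    · rw [hE u hu, sub_eq_add_neg, ← EReal.coe_neg, bot_lt_iff_ne_bot, ne_eq,
        EReal.add_eq_bot_iff, not_or]
      exact ⟨EReal.coe_ennreal_ne_bot _, EReal.coe_ne_bot _⟩
    · rw [hE u hu, ← EReal.coe_ennreal_toReal
        (ne_top_of_le_ne_top (hfin₀ hVl) (hmin u₀ hu₀)), ← EReal.coe_sub]
      exact EReal.coe_lt_top _
  -- If the shifted energy is infinite on the whole sphere, any member minimizes it, and the bump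
  -- function is a nonnegative one.
  by_cases h : ∃ v ∈ EGP.massSphere d c, EGP.shiftedEnergy V β l C v ≠ ⊤
  · obtain ⟨v, hv, hvt⟩ := h
    -- Minimization runs over a sublevel in `L²` without requiring `H¹`, which is recovered
    -- afterwards from finiteness of the shifted energy.
    obtain ⟨u, ⟨huc, hua⟩, hu⟩ := LowerSemicontinuousOn.exists_isMinOn
      (s := {u | ‖u‖ = c ∧ EGP.shiftedEnergy V β l C u ≤ EGP.shiftedEnergy V β l C v})
      (f := EGP.shiftedEnergy V β l C) ⟨v, hv.2, le_rfl⟩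
      (EGP.isCompact_shiftedEnergy_sublevel hVm hV hC c hvt)
      ((EGP.lowerSemicontinuous_shiftedEnergy hVm).lowerSemicontinuousOn _)
    have hle := EGP.shiftedEnergy_modulus_le (V := V) (β := β) (l := l) (C := C) u
    refine ⟨EGP.modulus u, ⟨EGP.memH1_of_shiftedEnergy_ne_top
      (ne_top_of_le_ne_top hvt (hle.trans hua)), (EGP.norm_modulus u).trans huc⟩, ?_,
      fun w hw => hle.trans ?_⟩
    · filter_upwards [EGP.coeFn_modulus u] with x hx
      rw [hx]
      exact ⟨by simp, by simp⟩
    -- A competitor outside the sublevel has at least the energy of `v`, which already bounds that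
    -- of `u`.
    · rcases le_total (EGP.shiftedEnergy V β l C w) (EGP.shiftedEnergy V β l C v) with h | h
      · exact isMinOn_iff.1 hu w ⟨hw.2, h⟩
      · exact hua.trans h
  · push Not at h
    exact ⟨u₀, hu₀, hpos₀, fun v hv => (h v hv).symm ▸ le_top⟩
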